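/- Let $\alpha,q:\mathbb{R}\to[0,\infty)$ be measurable with $0<\int_{\mathbb{R}}\alpha(x)\,dx<\infty$ and $\int_{\mathbb{R}}q(x)\,dx=1$, and suppose that $$\sigma^2:=\frac{\int_{\mathbb{R}}\alpha(x)^2/q(x)\,dx}{\left(\int_{\mathbb{R}}\alpha(x)\,dx\right)^2}-1<+\infty$$ (with the conventions $0/0=0$ and $a/0=+\infty$ for $a>0$). Fix integers $n,N\ge 1$ and a real $0<c<\infty$, and let $M_d=d/c$ up to rounding; more generally, let $(M_d)_{d\ge1}$ be any sequence of nonnegative integers with $M_d\sim d/c$ as $d\to\infty$. For each $d$ let $X_k^{i,l}(j)$ ($1\le k\le n$, $1\le i\le N$, $1\le l\le M_d$, $1\le j\le d$) be i.i.d. real random variables with density $q$, and put $$\mathbf{G}_k\big(X_k^{i,1:M_d}(1:d)\big)=\prod_{j=1}^d\frac1{M_d}\sum_{l=1}^{M_d}\frac{\alpha(X_k^{i,l}(j))}{q(X_k^{i,l}(j))},\qquad p^{N,M_d}(y_{1:n})=\prod_{k=1}^n\frac1N\sum_{i=1}^N\mathbf{G}_k\big(X_k^{i,1:M_d}(1:d)\big),$$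 $$p(y_{1:n})=\int_{\mathbb{R}^{nd}}\prod_{k=1}^n\prod_{j=1}^d\alpha(x_k(j))\,dx_{1:n}.$$ Let $V_k^i$ ($1\le k\le n$, $1\le i\le N$) be i.i.d. random variables with the log-normal law $\mathcal{LN}(-c\sigma^2/2,\,c\sigma^2)$, i.e. the law of $e^{Z}$ with $Z\sim\mathcal{N}(-c\sigma^2/2,\,c\sigma^2)$ (the point mass at $1$ if $\sigma^2=0$). Then, as $d\to\infty$, $$\frac{\mathbf{G}_k\big(X_k^{i,1:M_d}(1:d)\big)}{\left(\int_{\mathbb{R}}\alpha(x)\,dx\right)^d}\Rightarrow V_k^i\quad\text{for all }1\le k\le n,\ 1\le i\le N,$$ and $$\frac{p^{N,M_d}(y_{1:n})}{p(y_{1:n})}\Rightarrow\prod_{k=1}^n\frac1N\sum_{i=1}^N V_k^i,$$ where $\Rightarrow$ denotes convergence in distribution. -/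

import Mathlib

open MeasureTheory ProbabilityTheory Filter Topology Asymptotics
open scoped ENNReal NNReal

namespace SpaceTimePF

noncomputable section

/-- The log-normal distribution `LN(m, v)`: the law of `exp Z` with `Z ∼ N(m, v)`
(`v` is the variance of `Z`; for `v = 0` this is the point mass at `exp m`). -/
def logNormal (m : ℝ) (v : ℝ≥0) : Measure ℝ :=
  (gaussianReal m v).map Real.exp

/-- The probability distribution on `ℝ` with Lebesgue density `q`. -/
def proposalLaw (q : ℝ → ℝ) : Measure ℝ :=
  volume.withDensity fun x => ENNReal.ofReal (q x)

/-- `σ² = (∫ α² / q) / (∫ α)² - 1`, as an extended nonnegative number. In `ℝ≥0∞` one has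
`0 / 0 = 0` and `a / 0 = ∞` for `a ≠ 0`, so that `σ² < ∞` forces `α = 0` almost everywhere on
`{q = 0}`; the subtraction does not truncate when `q` is a probability density, by the
Cauchy–Schwarz inequality. -/
def sigmaSq (α q : ℝ → ℝ) : ℝ≥0∞ :=
  (∫⁻ x, ENNReal.ofReal (α x) ^ 2 / ENNReal.ofReal (q x)) /
    (∫⁻ x, ENNReal.ofReal (α x)) ^ 2 - 1

/-- The weight `𝐆(x) = ∏_{j ≤ d} (1/M) ∑_{l ≤ M} α(x^l(j)) / q(x^l(j))` of a local system of `M`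
particles with `d` coordinates; `x l j` is coordinate `j` of particle `l`. -/
def localWeight (α q : ℝ → ℝ) {M d : ℕ} (x : Fin M → Fin d → ℝ) : ℝ :=
  ∏ j, (1 / (M : ℝ)) * ∑ l, α (x l j) / q (x l j)

/-- The estimate `p^{N,M}(y_{1:n}) = ∏_{k ≤ n} (1/N) ∑_{i ≤ N} 𝐆_k(x_k^{i,1:M}(1:d))`;
`x k i l j` is `x_k^{i,l}(j)`. -/
def normConstEstimate (α q : ℝ → ℝ) {n N M d : ℕ}
    (x : Fin n → Fin N → Fin M → Fin d → ℝ) : ℝ :=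
  ∏ k, (1 / (N : ℝ)) * ∑ i, localWeight α q (x k i)

/-- The normalizing constant
`p(y_{1:n}) = ∫_{ℝ^{nd}} ∏_{k ≤ n} ∏_{j ≤ d} α(x_k(j)) dx_{1:n}`. -/
def normConst (α : ℝ → ℝ) (n d : ℕ) : ℝ :=
  ∫ x : Fin n → Fin d → ℝ, ∏ k, ∏ j, α (x k j)

end

end SpaceTimePF

namespace SpaceTimePF

/-! Let w = α / (q ∫α). Under q it is nonnegative, with mean 1 and second moment 1 + s, where s =
σ². The normalized weight 𝐆 is a product over d independent coordinates of averages A_j = 1 + ∑_l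
(w_l - 1)/M. The logarithm of an average is awkward to handle under second moments alone, so A_j is
replaced by B_j = ∏_l (1 + (w_l - 1)/M), whose expansion has A_j as its part of degree at most one.
The terms of higher degree are orthogonal to A_j, so E[A_j B_j] = E[A_j²] = 1 + s/M, while E[B_j²] =
(1 + s/M²)^M. Independence over j gives E(∏A_j - ∏B_j)² = (1 + s/M²)^(Md) - (1 + s/M)^d, and both
terms tend to exp(cs) because d/M → c (`integral_prod_meanWeight_sub_prod_tiltWeight_sq`). An L²
form of Slutsky's theorem then allows ∏B_j to stand in for ∏A_j.

Now log ∏B_j is a sum of Md i.i.d. terms log(1 + (w - 1)/M). Expanding (1 + x)^(it) to second order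
at x = (w - 1)/M, where the linear term has mean zero, gives the characteristic function (1 +
g)^(Md) with M² g → -(t² + it)s/2. Its limit exp(-c(t² + it)s/2) is that of N(-cs/2, cs)
(`tendsto_charFun_logTilt`). Since w ≥ 0, x ≥ -1/2 once M ≥ 2; this yields a quadratic bound on the
remainder, and dominated convergence needs no moment beyond the second.

Finally, the blocks indexed by (k, i) are i.i.d., weak convergence passes to finite product
measures, and both claims are continuous images of the joint limit. -/

/-! ### Limits of powers (1 + g)^k -/

/-- If `g → 0` and `k g → τ` then `(1 + g) ^ k → exp τ`. -/
lemma tendsto_one_add_pow_cexp {ι : Type*} {l : Filter ι} {k : ι → ℕ} {g : ι → ℂ} {τ : ℂ}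
    (hg : Tendsto g l (𝓝 0)) (hkg : Tendsto (fun a => (k a : ℂ) * g a) l (𝓝 τ)) :
    Tendsto (fun a => (1 + g a) ^ k a) l (𝓝 (Complex.exp τ)) := by
  have hsmall : ∀ᶠ a in l, ‖g a‖ < 1 / 2 :=
    hg.norm.eventually_lt_const (by simp)
  have hlog : Tendsto (fun a => (k a : ℂ) * Complex.log (1 + g a)) l (𝓝 τ) := by
    -- The error k (log(1 + g) - g) is at most |k g| |g|: a bounded factor times a vanishing one.
    have hdiff : Tendsto (fun a => (k a : ℂ) * (Complex.log (1 + g a) - g a)) l (𝓝 0) := by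
      have hb : Tendsto (fun a => ‖(k a : ℂ) * g a‖ * ‖g a‖) l (𝓝 0) := by
        simpa using hkg.norm.mul hg.norm
      refine squeeze_zero_norm' ?_ hb
      filter_upwards [hsmall] with a ha
      have h1 := Complex.norm_log_one_add_sub_self_le (z := g a) (by linarith)
      have h2 : (1 - ‖g a‖)⁻¹ ≤ 2 := by
        rw [inv_le_comm₀ (by linarith) two_pos]; linarith
      have h3 : ‖Complex.log (1 + g a) - g a‖ ≤ ‖g a‖ * ‖g a‖ := by
        refine h1.trans ?_
        nlinarith [sq_nonneg ‖g a‖]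
      rw [norm_mul, norm_mul, mul_assoc]
      exact mul_le_mul_of_nonneg_left h3 (norm_nonneg _)
    simpa [mul_sub] using hdiff.add hkg
  refine ((Complex.continuous_exp.tendsto _).comp hlog).congr' ?_
  filter_upwards [hsmall] with a ha
  have hne : 1 + g a ≠ 0 := by
    intro h
    have : g a = -1 := by linear_combination h
    rw [this] at ha
    norm_num at ha
  rw [Function.comp_apply, Complex.exp_nat_mul, Complex.exp_log hne]

/-- If `g → 0` and `k g → τ` then `(1 + g) ^ k → exp τ`. -/
lemma tendsto_one_add_pow_exp {ι : Type*} {l : Filter ι} {k : ι → ℕ} {g : ι → ℝ} {τ : ℝ}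
    (hg : Tendsto g l (𝓝 0)) (hkg : Tendsto (fun a => (k a : ℝ) * g a) l (𝓝 τ)) :
    Tendsto (fun a => (1 + g a) ^ k a) l (𝓝 (Real.exp τ)) := by
  have h := tendsto_one_add_pow_cexp (k := k) (g := fun a => (g a : ℂ)) (τ := τ)
    (by exact_mod_cast (Complex.continuous_ofReal.tendsto 0).comp hg)
    (by exact_mod_cast (Complex.continuous_ofReal.tendsto τ).comp hkg)
  have h2 := (Complex.continuous_re.tendsto _).comp h
  rw [← Complex.ofReal_exp, Complex.ofReal_re] at h2
  refine h2.congr fun a => ?_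
  rw [Function.comp_apply, ← Complex.ofReal_one, ← Complex.ofReal_add, ← Complex.ofReal_pow,
    Complex.ofReal_re]

/-! ### Expansion of (1 + x)^(it) at the origin -/

/-- The remainder of first order at `x = 0` of `x ↦ (1 + x) ^ (i t)`. -/
noncomputable def phaseRemainder (t x : ℝ) : ℂ :=
  Complex.exp ((t * Real.log (1 + x) : ℝ) * Complex.I) - 1 - (t * x : ℝ) * Complex.I

lemma norm_cexp_mul_I_sub_one_sub_le (x : ℝ) :
    ‖Complex.exp (x * Complex.I) - 1 - x * Complex.I‖ ≤ 2 * x ^ 2 := by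
  have hn : ‖(x : ℂ) * Complex.I‖ = |x| := by simp
  rcases le_or_gt |x| 1 with h | h
  · have := Complex.norm_exp_sub_one_sub_id_le (x := x * Complex.I) (by rwa [hn])
    rw [hn, sq_abs] at this
    nlinarith [sq_nonneg x]
  · have h1 : ‖Complex.exp (x * Complex.I) - 1‖ ≤ |x| := by
      rw [mul_comm]; exact Real.norm_exp_I_mul_ofReal_sub_one_le
    have h2 := norm_sub_le (Complex.exp (x * Complex.I) - 1) (x * Complex.I)
    rw [hn] at h2
    nlinarith [sq_abs x]

lemma abs_log_one_add_sub_self_le {x : ℝ} (hx : -(1 / 2) ≤ x) :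
    |Real.log (1 + x) - x| ≤ 2 * x ^ 2 := by
  have hpos : 0 < 1 + x := by linarith
  have h1 := Real.log_le_sub_one_of_pos hpos
  have h2 := Real.one_sub_inv_le_log_of_pos hpos
  have h3 : x - 2 * x ^ 2 ≤ 1 - (1 + x)⁻¹ := by
    have : 1 - (1 + x)⁻¹ - (x - 2 * x ^ 2) = x ^ 2 * (1 + 2 * x) / (1 + x) := by
      field_simp; ring
    have h4 : 0 ≤ x ^ 2 * (1 + 2 * x) / (1 + x) :=
      div_nonneg (mul_nonneg (sq_nonneg _) (by linarith)) hpos.le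
    linarith
  rw [abs_le]
  constructor <;> nlinarith [sq_nonneg x]

lemma abs_log_one_add_le {x : ℝ} (hx : -(1 / 2) ≤ x) : |Real.log (1 + x)| ≤ 2 * |x| := by
  have hpos : 0 < 1 + x := by linarith
  have h1 := Real.log_le_sub_one_of_pos hpos
  have h2 := Real.one_sub_inv_le_log_of_pos hpos
  rcases le_or_gt 0 x with h | h
  · rw [abs_of_nonneg h, abs_of_nonneg (Real.log_nonneg (by linarith))]
    linarith
  · rw [abs_of_neg h, abs_of_nonpos (Real.log_nonpos hpos.le (by linarith))]
    have : 2 * x ≤ 1 - (1 + x)⁻¹ := by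
      have h4 : 1 - (1 + x)⁻¹ - 2 * x = -x * (1 + 2 * x) / (1 + x) := by
        field_simp; ring
      have h5 : 0 ≤ -x * (1 + 2 * x) / (1 + x) :=
        div_nonneg (mul_nonneg (by linarith) (by linarith)) hpos.le
      linarith
    linarith

/-- A global quadratic bound on x ≥ -1/2, with no upper restriction on x: it supplies the dominating
function when w has only two moments. -/
lemma norm_phaseRemainder_le (t : ℝ) {x : ℝ} (hx : -(1 / 2) ≤ x) :
    ‖phaseRemainder t x‖ ≤ (8 * t ^ 2 + 2 * |t|) * x ^ 2 := by
  set u := Real.log (1 + x) with hu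
  have hdec : phaseRemainder t x =
      (Complex.exp ((t * u : ℝ) * Complex.I) - 1 - (t * u : ℝ) * Complex.I) +
        (t * (u - x) : ℝ) * Complex.I := by
    simp only [phaseRemainder, ← hu]
    push_cast
    ring
  rw [hdec]
  have h1 := norm_cexp_mul_I_sub_one_sub_le (t * u)
  have h2 : ‖((t * (u - x) : ℝ) : ℂ) * Complex.I‖ ≤ |t| * (2 * x ^ 2) := by
    rw [norm_mul, Complex.norm_I, mul_one, Complex.norm_real, Real.norm_eq_abs, abs_mul]
    exact mul_le_mul_of_nonneg_left (abs_log_one_add_sub_self_le hx) (abs_nonneg t)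
  have h3 : u ^ 2 ≤ 4 * x ^ 2 := by
    have := pow_le_pow_left₀ (abs_nonneg _) (abs_log_one_add_le hx) 2
    rw [mul_pow, sq_abs, sq_abs] at this
    linarith
  refine (norm_add_le _ _).trans ?_
  nlinarith [mul_le_mul_of_nonneg_left h3 (sq_nonneg t)]

/-- The second order expansion of `x ↦ (1 + x) ^ (i t)` at `x = 0`. -/
lemma phaseRemainder_isLittleO (t : ℝ) :
    (fun x : ℝ => phaseRemainder t x - (-(t ^ 2 : ℂ) - t * Complex.I) / 2 * (x : ℂ) ^ 2)
      =o[𝓝 0] fun x : ℝ => x ^ 2 := by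
  have hu0 : Tendsto (fun x : ℝ => Real.log (1 + x)) (𝓝 0) (𝓝 0) := by
    have : ContinuousAt (fun x : ℝ => Real.log (1 + x)) 0 :=
      (by fun_prop : ContinuousAt (fun x : ℝ => 1 + x) 0).log (by norm_num)
    simpa [ContinuousAt] using this
  have hge : ∀ᶠ x : ℝ in 𝓝 0, -(1 / 2) ≤ x := by
    filter_upwards [Ioi_mem_nhds (show (-(1 / 2) : ℝ) < 0 by norm_num)] with x hx using hx.le
  have huO : (fun x : ℝ => Real.log (1 + x)) =O[𝓝 0] fun x : ℝ => x :=
    IsBigO.of_bound 2 (by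
      filter_upwards [hge] with x hx
      simpa using abs_log_one_add_le hx)
  have husO : (fun x : ℝ => Real.log (1 + x) - x) =O[𝓝 0] fun x : ℝ => x ^ 2 :=
    IsBigO.of_bound 2 (by
      filter_upwards [hge] with x hx
      simpa using abs_log_one_add_sub_self_le hx)
  -- With u = log(1 + x), three approximations are combined: exp(itu) by its quadratic Taylor
  -- polynomial, u by x - x²/2 in the linear term, and u² by x² in the quadratic term. The x²
  -- coefficient is thus -it/2 - t²/2.
  have hE : (fun x : ℝ => Complex.exp ((t * Real.log (1 + x) : ℝ) * Complex.I) -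
      ∑ m ∈ Finset.range 3, ((t * Real.log (1 + x) : ℝ) * Complex.I) ^ m / (m.factorial : ℂ))
      =o[𝓝 0] fun x : ℝ => x ^ 2 := by
    have ht : Tendsto (fun x : ℝ => ((t * Real.log (1 + x) : ℝ) : ℂ) * Complex.I)
        (𝓝 0) (𝓝 0) := by
      have := ((Complex.continuous_ofReal.tendsto _).comp (hu0.const_mul t)).mul_const Complex.I
      simpa using this
    have h1 := (Complex.exp_sub_sum_range_succ_isLittleO_pow 2).comp_tendsto ht
    refine h1.trans_isBigO ?_
    simp only [Function.comp_def]
    refine IsBigO.pow ?_ 2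
    refine IsBigO.of_norm_left ?_
    simpa using (huO.norm_left.const_mul_left |t|)
  have hL : (fun x : ℝ => ((t * (Real.log (1 + x) - x + x ^ 2 / 2) : ℝ) : ℂ) * Complex.I)
      =o[𝓝 0] fun x : ℝ => x ^ 2 := by
    have h1 : (fun x : ℝ => Real.log (1 + x) - x + x ^ 2 / 2) =O[𝓝 0] fun x : ℝ => x ^ 3 := by
      refine IsBigO.of_bound 2 ?_
      filter_upwards [Metric.ball_mem_nhds (0 : ℝ) (show (0 : ℝ) < 1 / 2 by norm_num)] with x hx
      have hx' : |x| < 1 / 2 := by simpa using hx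
      have h2 := Real.abs_log_sub_add_sum_range_le (x := -x) (by rw [abs_neg]; linarith) 2
      have h3 : (∑ i ∈ Finset.range 2, (-x) ^ (i + 1) / ((i : ℝ) + 1)) + Real.log (1 - -x) =
          Real.log (1 + x) - x + x ^ 2 / 2 := by
        simp [Finset.sum_range_succ]
        ring
      rw [h3, abs_neg] at h2
      rw [Real.norm_eq_abs, Real.norm_eq_abs, abs_pow]
      refine h2.trans ?_
      rw [div_le_iff₀ (by linarith)]
      have : 0 ≤ |x| ^ 3 := by positivity
      norm_num only
      nlinarith
    have h2 : (fun x : ℝ => Real.log (1 + x) - x + x ^ 2 / 2) =o[𝓝 0] fun x : ℝ => x ^ 2 :=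
      h1.trans_isLittleO (isLittleO_pow_pow (by norm_num))
    refine IsLittleO.of_norm_left ?_
    simpa only [norm_mul, Complex.norm_I, mul_one, Complex.norm_real] using
      (h2.const_mul_left t).norm_left
  have hQ : (fun x : ℝ => ((t ^ 2 / 2 * (Real.log (1 + x) ^ 2 - x ^ 2) : ℝ) : ℂ))
      =o[𝓝 0] fun x : ℝ => x ^ 2 := by
    have h1 : (fun x : ℝ => (Real.log (1 + x) - x) * (Real.log (1 + x) + x))
        =O[𝓝 0] fun x : ℝ => x ^ 2 * x :=
      husO.mul (huO.add (isBigO_refl _ _))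
    have h2 : (fun x : ℝ => x ^ 2 * x) =o[𝓝 0] fun x : ℝ => x ^ 2 := by
      simpa [pow_succ] using isLittleO_pow_pow (𝕜 := ℝ) (show 2 < 3 by norm_num)
    have h3 : (fun x : ℝ => Real.log (1 + x) ^ 2 - x ^ 2) =o[𝓝 0] fun x : ℝ => x ^ 2 :=
      (h1.trans_isLittleO h2).congr_left fun x => by ring
    refine IsLittleO.of_norm_left ?_
    simpa only [Complex.norm_real] using (h3.const_mul_left (t ^ 2 / 2)).norm_left
  refine ((hE.add hL).sub hQ).congr_left fun x => ?_
  simp only [phaseRemainder, Finset.sum_range_succ, Finset.sum_range_zero, Nat.factorial]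
  push_cast
  linear_combination (-(t : ℂ) ^ 2 * (Real.log (1 + x) : ℂ) ^ 2 / 2) * Complex.I_sq

/-! ### Slutsky's theorem with an L² perturbation -/

/-- Slutsky's theorem for real random variables on varying probability spaces, with an `L²`
perturbation. -/
lemma tendstoInDistribution_of_tendsto_integral_sub_sq {ι Ω' : Type*} {Ω : ι → Type*}
    {m : ∀ i, MeasurableSpace (Ω i)} {μ : ∀ i, Measure (Ω i)} [∀ i, IsProbabilityMeasure (μ i)]
    {m' : MeasurableSpace Ω'} {μ' : Measure Ω'} [IsProbabilityMeasure μ'] {l : Filter ι}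
    [l.IsCountablyGenerated] {X Y : ∀ i, Ω i → ℝ} {Z : Ω' → ℝ}
    (hX : TendstoInDistribution X l Z μ μ') (hY : ∀ i, AEMeasurable (Y i) (μ i))
    -- Needed besides the limit: the Bochner integral of a non-integrable square is 0 by convention.
    (hint : ∀ᶠ i in l, Integrable (fun ω => (Y i ω - X i ω) ^ 2) (μ i))
    (hlim : Tendsto (fun i => ∫ ω, (Y i ω - X i ω) ^ 2 ∂μ i) l (𝓝 0)) :
    TendstoInDistribution Y l Z μ μ' := by
  have hXt := tendsto_iff_forall_lipschitz_integral_tendsto.1 hX.tendsto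
  refine ⟨hY, hX.aemeasurable_limit, tendsto_iff_forall_lipschitz_integral_tendsto.2 ?_⟩
  rintro F ⟨C, hC⟩ ⟨L, hL⟩
  have hXF := hXt F ⟨C, hC⟩ ⟨L, hL⟩
  have hF : Continuous F := hL.continuous
  simp only [ProbabilityMeasure.coe_mk] at hXF ⊢
  have hmapX (i) : ∫ y, F y ∂(μ i).map (X i) = ∫ ω, F (X i ω) ∂μ i :=
    integral_map (hX.forall_aemeasurable i) hF.aestronglyMeasurable
  have hmapY (i) : ∫ y, F y ∂(μ i).map (Y i) = ∫ ω, F (Y i ω) ∂μ i :=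
    integral_map (hY i) hF.aestronglyMeasurable
  simp_rw [hmapX] at hXF
  simp_rw [hmapY]
  have hbound (x : ℝ) : ‖F x‖ ≤ ‖F 0‖ + C := by
    have h1 := hC x 0
    rw [Real.dist_eq] at h1
    have h2 := norm_add_le (F x - F 0) (F 0)
    rw [sub_add_cancel, Real.norm_eq_abs (F x - F 0)] at h2
    linarith
  have hintF {i} {W : Ω i → ℝ} (hW : AEMeasurable W (μ i)) :
      Integrable (fun ω => F (W ω)) (μ i) :=
    Integrable.of_bound (hF.measurable.comp_aemeasurable hW).aestronglyMeasurable (‖F 0‖ + C)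
      (ae_of_all _ fun _ => hbound _)
  have hdiff : Tendsto (fun i => ∫ ω, F (Y i ω) ∂μ i - ∫ ω, F (X i ω) ∂μ i) l (𝓝 0) := by
    have hs : Tendsto (fun i => (L : ℝ) * √(∫ ω, (Y i ω - X i ω) ^ 2 ∂μ i)) l (𝓝 0) := by
      simpa using (hlim.sqrt).const_mul (L : ℝ)
    refine squeeze_zero_norm' ?_ hs
    filter_upwards [hint] with i hi
    have hmeas : AEStronglyMeasurable (fun ω => Y i ω - X i ω) (μ i) :=
      ((hY i).sub (hX.forall_aemeasurable i)).aestronglyMeasurable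
    have hL2 : MemLp (fun ω => Y i ω - X i ω) 2 (μ i) :=
      (memLp_two_iff_integrable_sq hmeas).2 hi
    have hint1 : Integrable (fun ω => |Y i ω - X i ω|) (μ i) :=
      (hL2.integrable one_le_two).abs
    have hCS : ∫ ω, |Y i ω - X i ω| ∂μ i ≤ √(∫ ω, (Y i ω - X i ω) ^ 2 ∂μ i) := by
      refine Real.le_sqrt_of_sq_le ?_
      -- Cauchy–Schwarz, read off from the nonnegativity of the variance of |Y - X|.
      have hv := variance_nonneg |fun ω => Y i ω - X i ω| (μ i)
      rw [variance_eq_sub hL2.abs] at hv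
      simpa using hv
    rw [← integral_sub (hintF (hY i)) (hintF (hX.forall_aemeasurable i))]
    refine (norm_integral_le_integral_norm _).trans ?_
    refine le_trans ?_ (mul_le_mul_of_nonneg_left hCS L.2)
    rw [← integral_const_mul]
    refine integral_mono ((hintF (hY i)).sub (hintF (hX.forall_aemeasurable i))).norm
      (hint1.const_mul _) fun ω => ?_
    have := hL.dist_le_mul (Y i ω) (X i ω)
    simpa [Real.dist_eq] using this
  simpa using hdiff.add hXF

/-! ### Second moments of the averages and of the tilted products -/

section moments

variable {S : Type*} [MeasurableSpace S] {μ : Measure S} [IsProbabilityMeasure μ]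
  {w : S → ℝ} {s : ℝ}

/-- The empirical mean of the weights of a sample. -/
noncomputable def meanWeight (w : S → ℝ) {m : ℕ} (x : Fin m → S) : ℝ :=
  (1 / (m : ℝ)) * ∑ l, w (x l)

/-- The product of the factors `1 + (w - 1) / m` over a sample of size `m`. -/
noncomputable def tiltWeight (w : S → ℝ) {m : ℕ} (x : Fin m → S) : ℝ :=
  ∏ l, (1 + (w (x l) - 1) / m)

lemma measurable_meanWeight (hw : Measurable w) (m : ℕ) :
    Measurable (meanWeight w : (Fin m → S) → ℝ) := by
  unfold meanWeight
  fun_prop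

lemma measurable_tiltWeight (hw : Measurable w) (m : ℕ) :
    Measurable (tiltWeight w : (Fin m → S) → ℝ) := by
  unfold tiltWeight
  fun_prop

lemma memLp_meanWeight (hL2 : MemLp w 2 μ) (m : ℕ) :
    MemLp (meanWeight w : (Fin m → S) → ℝ) 2 (Measure.pi fun _ => μ) := by
  unfold meanWeight
  refine MemLp.const_mul ?_ _
  exact memLp_finsetSum _ fun l _ =>
    hL2.comp_measurePreserving (measurePreserving_eval (fun _ : Fin m => μ) l)

lemma integral_meanWeight (hL2 : MemLp w 2 μ) (hone : ∫ x, w x ∂μ = 1) {m : ℕ} (hm : m ≠ 0) :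
    ∫ x : Fin m → S, meanWeight w x ∂(Measure.pi fun _ => μ) = 1 := by
  unfold meanWeight
  rw [integral_const_mul, integral_finsetSum]
  · have (l : Fin m) : ∫ x : Fin m → S, w (x l) ∂(Measure.pi fun _ => μ) = 1 := by
      rw [integral_comp_eval (μ := fun _ : Fin m => μ) hL2.1, hone]
    simp [this, hm]
  · exact fun l _ => (hL2.comp_measurePreserving
      (measurePreserving_eval (fun _ : Fin m => μ) l)).integrable one_le_two

lemma integral_meanWeight_sq (hL2 : MemLp w 2 μ) (hone : ∫ x, w x ∂μ = 1)
    (hsq : ∫ x, w x ^ 2 ∂μ = 1 + s) {m : ℕ} (hm : m ≠ 0) :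
    ∫ x : Fin m → S, meanWeight w x ^ 2 ∂(Measure.pi fun _ => μ) = 1 + s / m := by
  have hvw : Var[w; μ] = s := by
    rw [variance_eq_sub hL2]
    simp [hone, hsq]
  have hv : Var[(meanWeight w : (Fin m → S) → ℝ); Measure.pi fun _ => μ] = s / m := by
    have h1 : (meanWeight w : (Fin m → S) → ℝ) =
        fun x => (1 / (m : ℝ)) * (∑ l, fun x : Fin m → S => w (x l)) x := by
      ext x
      simp [meanWeight]
    rw [h1, variance_const_mul, variance_sum_pi (fun _ => hL2)]
    simp [hvw]
    field_simp
  rw [variance_eq_sub (memLp_meanWeight hL2 m), integral_meanWeight hL2 hone hm] at hv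
  simp only [Pi.pow_apply] at hv
  linarith

lemma memLp_tiltFactor (hL2 : MemLp w 2 μ) (a : ℝ) : MemLp (fun x => 1 + (w x - 1) / a) 2 μ := by
  have h1 : MemLp (fun x => a⁻¹ * w x) 2 μ := hL2.const_mul a⁻¹
  have h2 : MemLp (fun _ : S => 1 - a⁻¹) 2 μ := memLp_const _
  refine (h2.add h1).ae_eq (ae_of_all _ fun x => ?_)
  simp only [Pi.add_apply]
  ring

lemma integral_tiltFactor (hL2 : MemLp w 2 μ) (hone : ∫ x, w x ∂μ = 1) (a : ℝ) :
    ∫ x, (1 + (w x - 1) / a) ∂μ = 1 := by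
  have hi := hL2.integrable one_le_two
  have h : (fun x => 1 + (w x - 1) / a) = fun x => (1 - a⁻¹) + a⁻¹ * w x := by
    ext x; ring
  rw [h, integral_add (integrable_const _) (hi.const_mul _), integral_const_mul, hone]
  simp

lemma integral_mul_tiltFactor (hL2 : MemLp w 2 μ) (hone : ∫ x, w x ∂μ = 1)
    (hsq : ∫ x, w x ^ 2 ∂μ = 1 + s) (a : ℝ) :
    ∫ x, w x * (1 + (w x - 1) / a) ∂μ = 1 + s / a := by
  have hi := hL2.integrable one_le_two
  have hi2 := hL2.integrable_sq
  have : (fun x => w x * (1 + (w x - 1) / a)) = fun x => (1 - 1 / a) * w x + 1 / a * w x ^ 2 := by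
    ext x; ring
  rw [this, integral_add (hi.const_mul _) (hi2.const_mul _), integral_const_mul,
    integral_const_mul, hone, hsq]
  ring

lemma integral_tiltFactor_sq (hL2 : MemLp w 2 μ) (hone : ∫ x, w x ∂μ = 1)
    (hsq : ∫ x, w x ^ 2 ∂μ = 1 + s) (a : ℝ) :
    ∫ x, (1 + (w x - 1) / a) ^ 2 ∂μ = 1 + s / a ^ 2 := by
  have hi := (memLp_tiltFactor hL2 a).integrable one_le_two
  have hi2 : Integrable (fun x => w x * (1 + (w x - 1) / a)) μ :=
    hL2.integrable_mul (memLp_tiltFactor hL2 a)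
  have : (fun x => (1 + (w x - 1) / a) ^ 2) =
      fun x => (1 - 1 / a) * (1 + (w x - 1) / a) + 1 / a * (w x * (1 + (w x - 1) / a)) := by
    ext x; ring
  rw [this, integral_add (hi.const_mul _) (hi2.const_mul _), integral_const_mul,
    integral_const_mul, integral_tiltFactor hL2 hone, integral_mul_tiltFactor hL2 hone hsq]
  ring

lemma integrable_tiltWeight_sq (hL2 : MemLp w 2 μ) (m : ℕ) :
    Integrable (fun x : Fin m → S => tiltWeight w x ^ 2) (Measure.pi fun _ => μ) := by
  simp_rw [tiltWeight, ← Finset.prod_pow]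
  exact Integrable.fintype_prod (f := fun _ x => (1 + (w x - 1) / (m : ℝ)) ^ 2)
    fun _ => (memLp_tiltFactor hL2 m).integrable_sq

lemma integral_tiltWeight_sq (hL2 : MemLp w 2 μ) (hone : ∫ x, w x ∂μ = 1)
    (hsq : ∫ x, w x ^ 2 ∂μ = 1 + s) (m : ℕ) :
    ∫ x : Fin m → S, tiltWeight w x ^ 2 ∂(Measure.pi fun _ => μ) = (1 + s / m ^ 2) ^ m := by
  simp_rw [tiltWeight, ← Finset.prod_pow]
  rw [integral_fintype_prod_eq_pow (fun x => (1 + (w x - 1) / (m : ℝ)) ^ 2),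
    integral_tiltFactor_sq hL2 hone hsq, Fintype.card_fin]

lemma memLp_tiltWeight (hw : Measurable w) (hL2 : MemLp w 2 μ) (m : ℕ) :
    MemLp (tiltWeight w : (Fin m → S) → ℝ) 2 (Measure.pi fun _ => μ) :=
  (memLp_two_iff_integrable_sq (measurable_tiltWeight hw m).aestronglyMeasurable).2
    (integrable_tiltWeight_sq hL2 m)

/-- In w(x_l) ∏_k (1 + (w(x_k) - 1)/m) every factor with k ≠ l has mean 1, so only coordinate l
contributes. The value equals the second moment of `meanWeight`, which is the orthogonality behind
the L² comparison. -/
lemma integral_meanWeight_mul_tiltWeight (hw : Measurable w) (hL2 : MemLp w 2 μ)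
    (hone : ∫ x, w x ∂μ = 1) (hsq : ∫ x, w x ^ 2 ∂μ = 1 + s) {m : ℕ} (hm : m ≠ 0) :
    ∫ x : Fin m → S, meanWeight w x * tiltWeight w x ∂(Measure.pi fun _ => μ) = 1 + s / m := by
  have hterm (l : Fin m) : (fun x : Fin m → S => w (x l) * tiltWeight w x) =
      fun x => ∏ k, (fun y => (if k = l then w y else 1) * (1 + (w y - 1) / m)) (x k) := by
    ext x
    rw [Finset.prod_mul_distrib, Finset.prod_ite_eq' Finset.univ l (fun k => w (x k))]
    simp [tiltWeight]
  have hint (l : Fin m) : ∫ x : Fin m → S, w (x l) * tiltWeight w x ∂(Measure.pi fun _ => μ) =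
      1 + s / m := by
    rw [hterm, integral_fintype_prod_eq_prod
      (fun k y => (if k = l then w y else 1) * (1 + (w y - 1) / (m : ℝ)))]
    rw [Finset.prod_eq_single l]
    · simp [integral_mul_tiltFactor hL2 hone hsq]
    · intro k _ hk
      simp [hk, integral_tiltFactor hL2 hone]
    · simp
  simp_rw [meanWeight, mul_assoc, Finset.sum_mul]
  rw [integral_const_mul, integral_finsetSum]
  · simp only [hint, Finset.sum_const, Finset.card_univ, Fintype.card_fin, nsmul_eq_mul]
    field_simp
  · exact fun l _ => (hL2.comp_measurePreserving
      (measurePreserving_eval (fun _ : Fin m => μ) l)).integrable_mul (memLp_tiltWeight hw hL2 m)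

/-- The `L²` distance between the product of `d` independent empirical means and the corresponding
product of tilted weights. -/
lemma integral_prod_meanWeight_sub_prod_tiltWeight_sq (hw : Measurable w) (hL2 : MemLp w 2 μ)
    (hone : ∫ x, w x ∂μ = 1) (hsq : ∫ x, w x ^ 2 ∂μ = 1 + s) (d : ℕ) {m : ℕ} (hm : m ≠ 0) :
    Integrable (fun x : Fin d → Fin m → S =>
        (∏ j, meanWeight w (x j) - ∏ j, tiltWeight w (x j)) ^ 2)
        (Measure.pi fun _ => Measure.pi fun _ => μ) ∧
      ∫ x : Fin d → Fin m → S, (∏ j, meanWeight w (x j) - ∏ j, tiltWeight w (x j)) ^ 2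
        ∂(Measure.pi fun _ => Measure.pi fun _ => μ) =
      (1 + s / m ^ 2) ^ (m * d) - (1 + s / m) ^ d := by
  have hexp : (fun x : Fin d → Fin m → S =>
      (∏ j, meanWeight w (x j) - ∏ j, tiltWeight w (x j)) ^ 2) = fun x =>
      (∏ j, meanWeight w (x j) ^ 2 - 2 * ∏ j, (meanWeight w (x j) * tiltWeight w (x j))) +
        ∏ j, tiltWeight w (x j) ^ 2 := by
    ext x
    simp only [Finset.prod_pow, Finset.prod_mul_distrib]
    ring
  have h1 : Integrable (fun x : Fin d → Fin m → S => ∏ j, meanWeight w (x j) ^ 2)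
      (Measure.pi fun _ => Measure.pi fun _ => μ) :=
    Integrable.fintype_prod (f := fun _ y => meanWeight w y ^ 2)
      fun _ => (memLp_meanWeight hL2 m).integrable_sq
  have h2 : Integrable (fun x : Fin d → Fin m → S =>
      ∏ j, (meanWeight w (x j) * tiltWeight w (x j)))
      (Measure.pi fun _ => Measure.pi fun _ => μ) :=
    Integrable.fintype_prod (f := fun _ y => meanWeight w y * tiltWeight w y)
      fun _ => (memLp_meanWeight hL2 m).integrable_mul (memLp_tiltWeight hw hL2 m)
  have h3 : Integrable (fun x : Fin d → Fin m → S => ∏ j, tiltWeight w (x j) ^ 2)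
      (Measure.pi fun _ => Measure.pi fun _ => μ) :=
    Integrable.fintype_prod (f := fun _ y => tiltWeight w y ^ 2)
      fun _ => integrable_tiltWeight_sq hL2 m
  rw [hexp]
  refine ⟨(h1.sub (h2.const_mul 2)).add h3, ?_⟩
  have h12 : Integrable (fun x : Fin d → Fin m → S => ∏ j, meanWeight w (x j) ^ 2 -
      2 * ∏ j, (meanWeight w (x j) * tiltWeight w (x j)))
      (Measure.pi fun _ => Measure.pi fun _ => μ) := h1.sub (h2.const_mul 2)
  rw [integral_add h12 h3, integral_sub h1 (h2.const_mul 2),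
    integral_const_mul, integral_fintype_prod_eq_pow (fun y : Fin m → S => meanWeight w y ^ 2),
    integral_fintype_prod_eq_pow (fun y : Fin m → S => meanWeight w y * tiltWeight w y),
    integral_fintype_prod_eq_pow (fun y : Fin m → S => tiltWeight w y ^ 2),
    integral_meanWeight_sq hL2 hone hsq hm, integral_meanWeight_mul_tiltWeight hw hL2 hone hsq hm,
    integral_tiltWeight_sq hL2 hone hsq, Fintype.card_fin, ← pow_mul]
  ring

end moments

/-! ### Asymptotic log-normality of a single block -/

section limit

variable {S : Type*} [MeasurableSpace S] {μ : Measure S} [IsProbabilityMeasure μ]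
  {w : S → ℝ} {s : ℝ}

/-- The logarithm of a product of tilted weights over `d` independent samples of size `m`. -/
noncomputable def logTilt (w : S → ℝ) {d m : ℕ} (x : Fin d → Fin m → S) : ℝ :=
  ∑ j, ∑ l, Real.log (1 + (w (x j l) - 1) / m)

lemma measurable_logTilt (hw : Measurable w) (d m : ℕ) :
    Measurable (logTilt w : (Fin d → Fin m → S) → ℝ) := by
  unfold logTilt
  fun_prop

lemma neg_half_le_div {y : ℝ} (hy : -1 ≤ y) {m : ℕ} (hm : 2 ≤ m) : -(1 / 2) ≤ y / m := by
  have h2 : (2 : ℝ) ≤ m := by exact_mod_cast hm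
  rw [le_div_iff₀ (by linarith)]
  linarith

lemma exp_logTilt {S : Type*} {w : S → ℝ} (hw0 : ∀ x, 0 ≤ w x) {d m : ℕ} (hm : 2 ≤ m)
    (x : Fin d → Fin m → S) :
    Real.exp (logTilt w x) = ∏ j, tiltWeight w (x j) := by
  simp_rw [logTilt, Real.exp_sum, tiltWeight]
  refine Finset.prod_congr rfl fun j _ => Finset.prod_congr rfl fun l _ => Real.exp_log ?_
  have := neg_half_le_div (y := w (x j l) - 1) (by linarith [hw0 (x j l)]) hm
  linarith

/-- The logarithm turns the double product into a sum of m * d i.i.d. terms, so the characteristic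
function is a power. -/
lemma charFun_map_logTilt (hw : Measurable w) (d m : ℕ) (t : ℝ) :
    charFun ((Measure.pi fun _ : Fin d => Measure.pi fun _ : Fin m => μ).map (logTilt w)) t =
      (∫ x, Complex.exp ((t * Real.log (1 + (w x - 1) / m) : ℝ) * Complex.I) ∂μ) ^ (m * d) := by
  have hexp (x : Fin d → Fin m → S) : Complex.exp (t * logTilt w x * Complex.I) =
      ∏ j, ∏ l, Complex.exp ((t * Real.log (1 + (w (x j l) - 1) / m) : ℝ) * Complex.I) := by
    simp_rw [← Complex.exp_sum, logTilt]
    push_cast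
    simp_rw [Finset.mul_sum, Finset.sum_mul]
  rw [charFun_apply_real, integral_map (measurable_logTilt hw d m).aemeasurable (by fun_prop)]
  simp_rw [hexp]
  rw [integral_fintype_prod_eq_pow (fun y : Fin m → S =>
      ∏ l, Complex.exp ((t * Real.log (1 + (w (y l) - 1) / m) : ℝ) * Complex.I)),
    integral_fintype_prod_eq_pow (fun y : S =>
      Complex.exp ((t * Real.log (1 + (w y - 1) / m) : ℝ) * Complex.I)),
    Fintype.card_fin, Fintype.card_fin, ← pow_mul]

lemma measurable_phaseRemainder (t : ℝ) : Measurable (phaseRemainder t) := by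
  unfold phaseRemainder
  fun_prop

lemma tendsto_sq_mul_phaseRemainder (t y : ℝ) :
    Tendsto (fun m : ℕ => (m : ℂ) ^ 2 * phaseRemainder t (y / m)) atTop
      (𝓝 ((-(t ^ 2 : ℂ) - t * Complex.I) / 2 * (y : ℂ) ^ 2)) := by
  have h0 : Tendsto (fun m : ℕ => y / (m : ℝ)) atTop (𝓝 0) :=
    tendsto_const_div_atTop_nhds_zero_nat y
  have h1 := (phaseRemainder_isLittleO t).comp_tendsto h0
  have h2 : (fun m : ℕ => (m : ℂ) ^ 2 * (phaseRemainder t (y / m) -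
      (-(t ^ 2 : ℂ) - t * Complex.I) / 2 * ((y / m : ℝ) : ℂ) ^ 2)) =o[atTop]
      fun m : ℕ => (m : ℝ) ^ 2 * (y / m) ^ 2 := by
    refine IsBigO.mul_isLittleO ?_ h1
    exact IsBigO.of_bound 1 (Eventually.of_forall fun m => by simp)
  have h3 : (fun m : ℕ => (m : ℝ) ^ 2 * (y / m) ^ 2) =O[atTop] fun _ => (1 : ℝ) := by
    refine IsBigO.of_bound (y ^ 2) ?_
    filter_upwards [eventually_ne_atTop 0] with m hm
    have hm' : (m : ℝ) ≠ 0 := by exact_mod_cast hm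
    have : (m : ℝ) ^ 2 * (y / m) ^ 2 = y ^ 2 := by field_simp
    simp [this]
  have h4 := (isLittleO_one_iff ℝ).1 (h2.trans_isBigO h3)
  have h5 := h4.add_const ((-(t ^ 2 : ℂ) - t * Complex.I) / 2 * (y : ℂ) ^ 2)
  rw [zero_add] at h5
  refine h5.congr' ?_
  filter_upwards [eventually_ne_atTop 0] with m hm
  have hm' : (m : ℂ) ≠ 0 := by exact_mod_cast hm
  push_cast
  field_simp
  ring

/-- Dominated convergence: the integrand tends pointwise to its second-order coefficient times (w -
1)², whose mean is s, and is dominated by a multiple of the integrable (w - 1)². -/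
lemma tendsto_integral_sq_mul_phaseRemainder (hw : Measurable w) (hw0 : ∀ x, 0 ≤ w x)
    (hL2 : MemLp w 2 μ) (hone : ∫ x, w x ∂μ = 1) (hsq : ∫ x, w x ^ 2 ∂μ = 1 + s) (t : ℝ) :
    Tendsto (fun m : ℕ => ∫ x, (m : ℂ) ^ 2 * phaseRemainder t ((w x - 1) / m) ∂μ) atTop
      (𝓝 ((-(t ^ 2 : ℂ) - t * Complex.I) / 2 * s)) := by
  have hi := hL2.integrable one_le_two
  have hy2 : Integrable (fun x => (w x - 1) ^ 2) μ :=
    (hL2.sub (memLp_const (1 : ℝ))).integrable_sq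
  have hs : ∫ x, (w x - 1) ^ 2 ∂μ = s := by
    have h2 : (fun x => (w x - 1) ^ 2) = fun x => (w x ^ 2 - 2 * w x) + 1 := by ext x; ring
    have h3 : Integrable (fun x => w x ^ 2 - 2 * w x) μ := hL2.integrable_sq.sub (hi.const_mul 2)
    rw [h2, integral_add h3 (integrable_const _),
      integral_sub hL2.integrable_sq (hi.const_mul 2), integral_const_mul, hone, hsq]
    simp
    ring
  have hlim : (-(t ^ 2 : ℂ) - t * Complex.I) / 2 * s =
      ∫ x, (-(t ^ 2 : ℂ) - t * Complex.I) / 2 * ((w x - 1 : ℝ) : ℂ) ^ 2 ∂μ := by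
    rw [integral_const_mul, ← hs, ← integral_complex_ofReal]
    simp
  rw [hlim]
  refine tendsto_integral_filter_of_dominated_convergence
    (fun x => (8 * t ^ 2 + 2 * |t|) * (w x - 1) ^ 2) ?_ ?_ (hy2.const_mul _) ?_
  · refine Eventually.of_forall fun m => Measurable.aestronglyMeasurable ?_
    exact ((measurable_phaseRemainder t).comp ((hw.sub_const 1).div_const _)).const_mul _
  · filter_upwards [eventually_ge_atTop 2] with m hm
    refine ae_of_all _ fun x => ?_
    have h := norm_phaseRemainder_le t
      (neg_half_le_div (y := w x - 1) (by linarith [hw0 x]) hm)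
    have hm' : (m : ℝ) ≠ 0 := by positivity
    rw [norm_mul, norm_pow, Complex.norm_natCast]
    calc (m : ℝ) ^ 2 * ‖phaseRemainder t ((w x - 1) / m)‖
        ≤ (m : ℝ) ^ 2 * ((8 * t ^ 2 + 2 * |t|) * ((w x - 1) / m) ^ 2) := by gcongr
      _ = (8 * t ^ 2 + 2 * |t|) * (w x - 1) ^ 2 := by field_simp
  · exact ae_of_all _ fun x => tendsto_sq_mul_phaseRemainder t (w x - 1)

/-- The first-order term it(w - 1)/m integrates to zero because w has mean 1. -/
lemma integral_cexp_log_eq (hw : Measurable w) (hL2 : MemLp w 2 μ)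
    (hone : ∫ x, w x ∂μ = 1) (t : ℝ) (m : ℕ) :
    ∫ x, Complex.exp ((t * Real.log (1 + (w x - 1) / m) : ℝ) * Complex.I) ∂μ =
      1 + ∫ x, phaseRemainder t ((w x - 1) / m) ∂μ := by
  have hi := hL2.integrable one_le_two
  have hE : Integrable
      (fun x => Complex.exp ((t * Real.log (1 + (w x - 1) / m) : ℝ) * Complex.I)) μ := by
    refine Integrable.of_bound (Measurable.aestronglyMeasurable (by fun_prop)) 1
      (ae_of_all _ fun x => ?_)
    rw [Complex.norm_exp_ofReal_mul_I]
  have hy : Integrable (fun x => t * ((w x - 1) / m)) μ :=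
    ((hi.sub (integrable_const 1)).div_const _).const_mul t
  have hy0 : ∫ x, t * ((w x - 1) / m) ∂μ = 0 := by
    rw [integral_const_mul, integral_div, integral_sub hi (integrable_const _), hone]
    simp
  have hI : Integrable (fun x => ((t * ((w x - 1) / m) : ℝ) : ℂ) * Complex.I) μ :=
    hy.ofReal.mul_const _
  have hE1 : Integrable
      (fun x => Complex.exp ((t * Real.log (1 + (w x - 1) / m) : ℝ) * Complex.I) - 1) μ :=
    hE.sub (integrable_const _)
  simp only [phaseRemainder]
  rw [integral_sub hE1 hI, integral_sub hE (integrable_const _), integral_mul_const,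
    integral_complex_ofReal, hy0]
  simp

variable {c : ℝ} {M : ℕ → ℕ}

lemma tendsto_atTop_of_isEquivalent_div (hc : 0 < c)
    (hM : (fun d : ℕ => (M d : ℝ)) ~[atTop] (fun d : ℕ => (d : ℝ) / c)) :
    Tendsto M atTop atTop := by
  have h : Tendsto (fun d : ℕ => (d : ℝ) / c) atTop atTop :=
    tendsto_natCast_atTop_atTop.atTop_div_const hc
  exact tendsto_natCast_atTop_iff.1 (hM.symm.tendsto_atTop h)

lemma tendsto_div_of_isEquivalent_div (hc : 0 < c)
    (hM : (fun d : ℕ => (M d : ℝ)) ~[atTop] (fun d : ℕ => (d : ℝ) / c)) :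
    Tendsto (fun d : ℕ => (d : ℝ) / M d) atTop (𝓝 c) := by
  have hMt := tendsto_atTop_of_isEquivalent_div hc hM
  have hne : ∀ᶠ d in atTop, (M d : ℝ) ≠ 0 := by
    filter_upwards [hMt.eventually_ne_atTop 0] with d hd using by exact_mod_cast hd
  have h := (isEquivalent_iff_tendsto_one hne).1 hM.symm
  have h2 := h.const_mul c
  rw [mul_one] at h2
  refine h2.congr fun d => ?_
  simp only [Pi.div_apply]
  field_simp

/-- The logarithm of the product of tilted weights is asymptotically normal. -/
lemma tendsto_charFun_logTilt (hw : Measurable w) (hw0 : ∀ x, 0 ≤ w x)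
    (hL2 : MemLp w 2 μ) (hone : ∫ x, w x ∂μ = 1) (hs : 0 ≤ s) (hsq : ∫ x, w x ^ 2 ∂μ = 1 + s)
    (hc : 0 < c) (hM : (fun d : ℕ => (M d : ℝ)) ~[atTop] (fun d : ℕ => (d : ℝ) / c)) (t : ℝ) :
    Tendsto (fun d => charFun
      ((Measure.pi fun _ : Fin d => Measure.pi fun _ : Fin (M d) => μ).map (logTilt w)) t) atTop
      (𝓝 (charFun (gaussianReal (-(c * s) / 2) (c * s).toNNReal) t)) := by
  have hMt := tendsto_atTop_of_isEquivalent_div hc hM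
  have hI := (tendsto_integral_sq_mul_phaseRemainder hw hw0 hL2 hone hsq t).comp hMt
  simp_rw [Function.comp_def, integral_const_mul] at hI
  have hinv : Tendsto (fun d => ((M d : ℂ) ^ 2)⁻¹) atTop (𝓝 0) := by
    have h1 : Tendsto (fun d => ((M d : ℝ))⁻¹) atTop (𝓝 0) :=
      tendsto_inv_atTop_zero.comp (tendsto_natCast_atTop_atTop.comp hMt)
    have h2 := (Complex.continuous_ofReal.tendsto _).comp (h1.pow 2)
    simpa [Function.comp_def] using h2
  have hg : Tendsto (fun d => ∫ x, phaseRemainder t ((w x - 1) / M d) ∂μ) atTop (𝓝 0) := by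
    have h1 := hinv.mul hI
    rw [zero_mul] at h1
    refine h1.congr' ?_
    filter_upwards [hMt.eventually_ne_atTop 0] with d hd
    have hd' : (M d : ℂ) ≠ 0 := by exact_mod_cast hd
    field_simp
  -- The exponent splits as M d = (d / M) M²: the ratio tends to c and M² normalizes the remainder.
  have hkg : Tendsto (fun d => ((M d * d : ℕ) : ℂ) *
      ∫ x, phaseRemainder t ((w x - 1) / M d) ∂μ) atTop
      (𝓝 (c * ((-(t ^ 2 : ℂ) - t * Complex.I) / 2 * s))) := by
    have hr := (Complex.continuous_ofReal.tendsto _).comp (tendsto_div_of_isEquivalent_div hc hM)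
    refine (hr.mul hI).congr' ?_
    filter_upwards [hMt.eventually_ne_atTop 0] with d hd
    have hd' : (M d : ℂ) ≠ 0 := by exact_mod_cast hd
    simp only [Function.comp_apply]
    push_cast
    field_simp
  have h := tendsto_one_add_pow_cexp hg hkg
  simp_rw [charFun_map_logTilt hw, integral_cexp_log_eq hw hL2 hone, charFun_gaussianReal]
  -- The term linear in t gives the mean -cs/2, the term in t² the variance cs.
  convert h using 3
  rw [Real.coe_toNNReal _ (by positivity)]
  push_cast
  ring

/-- The product of `d` independent empirical means of samples of size `M d ∼ d / c` is
asymptotically log-normal. -/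
lemma tendstoInDistribution_prod_meanWeight (hw : Measurable w) (hw0 : ∀ x, 0 ≤ w x)
    (hL2 : MemLp w 2 μ) (hone : ∫ x, w x ∂μ = 1) (hs : 0 ≤ s) (hsq : ∫ x, w x ^ 2 ∂μ = 1 + s)
    (hc : 0 < c) (hM : (fun d : ℕ => (M d : ℝ)) ~[atTop] (fun d : ℕ => (d : ℝ) / c)) :
    TendstoInDistribution
      (fun d (x : Fin d → Fin (M d) → S) => ∏ j, meanWeight w (x j)) atTop Real.exp
      (fun d => Measure.pi fun _ : Fin d => Measure.pi fun _ : Fin (M d) => μ)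
      (gaussianReal (-(c * s) / 2) (c * s).toNNReal) := by
  have hMt := tendsto_atTop_of_isEquivalent_div hc hM
  have hr := tendsto_div_of_isEquivalent_div hc hM
  have hlog : TendstoInDistribution (fun d (x : Fin d → Fin (M d) → S) => logTilt w x) atTop id
      (fun d => Measure.pi fun _ : Fin d => Measure.pi fun _ : Fin (M d) => μ)
      (gaussianReal (-(c * s) / 2) (c * s).toNNReal) := by
    refine ⟨fun d => (measurable_logTilt hw d (M d)).aemeasurable, aemeasurable_id,
      ProbabilityMeasure.tendsto_of_tendsto_charFun fun t => ?_⟩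
    simpa using tendsto_charFun_logTilt hw hw0 hL2 hone hs hsq hc hM t
  have hexp := hlog.continuous_comp Real.continuous_exp
  -- `Real.log` can be undone only where the tilted factors are positive, which w ≥ 0 ensures for M
  -- ≥ 2, hence eventually.
  have hdiff : ∀ᶠ d in atTop, Set.EqOn
      (fun x : Fin d → Fin (M d) → S => (∏ j, meanWeight w (x j) - Real.exp (logTilt w x)) ^ 2)
      (fun x => (∏ j, meanWeight w (x j) - ∏ j, tiltWeight w (x j)) ^ 2) Set.univ := by
    filter_upwards [hMt.eventually_ge_atTop 2] with d hd x _
    simp only [exp_logTilt hw0 hd]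
  have hm0 : Tendsto (fun d => s / (M d : ℝ)) atTop (𝓝 0) :=
    (tendsto_natCast_atTop_atTop.comp hMt).const_div_atTop s
  have hm1 : Tendsto (fun d => s / (M d : ℝ) ^ 2) atTop (𝓝 0) :=
    ((tendsto_pow_atTop two_ne_zero).comp
      (tendsto_natCast_atTop_atTop.comp hMt)).const_div_atTop s
  refine tendstoInDistribution_of_tendsto_integral_sub_sq hexp (fun d => ?_) ?_ ?_
  · have := measurable_meanWeight hw (M d)
    exact Measurable.aemeasurable (by fun_prop)
  · filter_upwards [hMt.eventually_ge_atTop 2, hdiff] with d hd h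
    have := (integral_prod_meanWeight_sub_prod_tiltWeight_sq hw hL2 hone hsq d
      (m := M d) (by omega)).1
    rwa [← Set.eqOn_univ _ _ |>.1 h] at this
  · have h1 : Tendsto (fun d => (1 + s / (M d : ℝ) ^ 2) ^ (M d * d)) atTop
        (𝓝 (Real.exp (s * c))) := by
      refine tendsto_one_add_pow_exp hm1 ((hr.const_mul s).congr' ?_)
      filter_upwards [hMt.eventually_ne_atTop 0] with d hd
      have hd' : (M d : ℝ) ≠ 0 := by exact_mod_cast hd
      push_cast
      field_simp
    have h2 : Tendsto (fun d => (1 + s / (M d : ℝ)) ^ d) atTop (𝓝 (Real.exp (s * c))) := by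
      refine tendsto_one_add_pow_exp hm0 ((hr.const_mul s).congr fun d => ?_)
      ring
    have h3 := h1.sub h2
    rw [sub_self] at h3
    refine h3.congr' ?_
    filter_upwards [hMt.eventually_ge_atTop 2, hdiff] with d hd h
    rw [← (integral_prod_meanWeight_sub_prod_tiltWeight_sq hw hL2 hone hsq d
      (m := M d) (by omega)).2, ← Set.eqOn_univ _ _ |>.1 h]
    rfl

end limit

/-! ### Product laws and joint convergence -/

section product

/-- Currying preserves finite product measures. -/
lemma measurePreserving_curry_pi {ι κ S : Type*} [Fintype ι] [Fintype κ] [MeasurableSpace S]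
    (μ : Measure S) [IsProbabilityMeasure μ] :
    MeasurePreserving (fun (x : ι × κ → S) i k => x (i, k)) (Measure.pi fun _ => μ)
      (Measure.pi fun _ => Measure.pi fun _ => μ) := by
  refine ⟨by fun_prop, ?_⟩
  have h := Measure.infinitePi_map_curry (fun (_ : ι) (_ : κ) => μ)
  simp_rw [Measure.infinitePi_eq_pi] at h
  exact h

/-- If `W d ⇒ W'`, then vectors with i.i.d. components distributed as `W d` converge in
distribution to the vector with i.i.d. components distributed as `W'`. -/
lemma tendstoInDistribution_of_hasLaw_pi {ι κ : Type*} [Fintype κ] {l : Filter ι}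
    {S Ω : ι → Type*} {S' Ω' : Type*} {mS : ∀ i, MeasurableSpace (S i)}
    {mΩ : ∀ i, MeasurableSpace (Ω i)} {mS' : MeasurableSpace S'} {mΩ' : MeasurableSpace Ω'}
    {μ : ∀ i, Measure (S i)} [∀ i, IsProbabilityMeasure (μ i)]
    {μ' : Measure S'} [IsProbabilityMeasure μ']
    {P : ∀ i, Measure (Ω i)} [∀ i, IsProbabilityMeasure (P i)]
    {P' : Measure Ω'} [IsProbabilityMeasure P']
    {W : ∀ i, S i → ℝ} {W' : S' → ℝ} (hW : TendstoInDistribution W l W' μ μ')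
    {Y : ∀ i, Ω i → κ → ℝ} {Z : Ω' → κ → ℝ}
    (hY : ∀ i, HasLaw (Y i) (Measure.pi fun _ => (μ i).map (W i)) (P i))
    (hZ : HasLaw Z (Measure.pi fun _ => μ'.map W') P') :
    TendstoInDistribution Y l Z P P' := by
  refine ⟨fun i => (hY i).aemeasurable, hZ.aemeasurable, ?_⟩
  let ν (i : ι) : ProbabilityMeasure ℝ :=
    ⟨(μ i).map (W i), Measure.isProbabilityMeasure_map (hW.forall_aemeasurable i)⟩
  let ν' : ProbabilityMeasure ℝ :=
    ⟨μ'.map W', Measure.isProbabilityMeasure_map hW.aemeasurable_limit⟩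
  have hν : Tendsto (fun i (_ : κ) => ν i) l (𝓝 fun _ => ν') :=
    tendsto_pi_nhds.2 fun _ => hW.tendsto
  -- Forming a finite product of probability measures is continuous for weak convergence.
  have hpi : Tendsto (fun i => ProbabilityMeasure.pi fun _ : κ => ν i) l
      (𝓝 (ProbabilityMeasure.pi fun _ : κ => ν')) :=
    (ProbabilityMeasure.continuous_pi.tendsto _).comp hν
  have hlim : (ProbabilityMeasure.pi fun _ : κ => ν') =
      ⟨P'.map Z, Measure.isProbabilityMeasure_map hZ.aemeasurable⟩ := Subtype.ext hZ.map_eq.symm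
  rw [hlim] at hpi
  exact hpi.congr fun i => Subtype.ext (hY i).map_eq.symm

end product

/-! ### Importance weights: moments and normalization -/

section weight

variable {α q : ℝ → ℝ}

/-- The normalized importance weight `α / q / ∫ α`. -/
noncomputable def importanceWeight (α q : ℝ → ℝ) (x : ℝ) : ℝ := α x / q x / ∫ y, α y

lemma measurable_importanceWeight (hα : Measurable α) (hq : Measurable q) :
    Measurable (importanceWeight α q) :=
  (hα.div hq).div_const _

lemma importanceWeight_nonneg (hα : ∀ x, 0 ≤ α x) (hq : ∀ x, 0 ≤ q x) (x : ℝ) :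
    0 ≤ importanceWeight α q x :=
  div_nonneg (div_nonneg (hα x) (hq x)) (integral_nonneg hα)

lemma isProbabilityMeasure_proposalLaw (hq_one : ∫⁻ x, ENNReal.ofReal (q x) = 1) :
    IsProbabilityMeasure (proposalLaw q) :=
  ⟨by rw [proposalLaw, withDensity_apply _ MeasurableSet.univ, Measure.restrict_univ, hq_one]⟩

/-- The second moment ratio `(∫ α² / q) / (∫ α)²`. -/
noncomputable def secondMomentRatio (α q : ℝ → ℝ) : ℝ≥0∞ :=
  (∫⁻ x, ENNReal.ofReal (α x) ^ 2 / ENNReal.ofReal (q x)) / (∫⁻ x, ENNReal.ofReal (α x)) ^ 2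

lemma secondMomentRatio_lt_top (hσ : sigmaSq α q < ∞) : secondMomentRatio α q < ∞ := by
  have h : sigmaSq α q = secondMomentRatio α q - 1 := rfl
  rw [lt_top_iff_ne_top]
  intro htop
  rw [h, htop] at hσ
  simp at hσ

lemma lintegral_ofReal_eq (hα_nonneg : ∀ x, 0 ≤ α x) (hα_int : Integrable α) :
    ∫⁻ x, ENNReal.ofReal (α x) = ENNReal.ofReal (∫ x, α x) :=
  (ofReal_integral_eq_lintegral_ofReal hα_int (ae_of_all _ hα_nonneg)).symm

-- Where q = 0 < α the integrand α²/q is infinite, so a finite integral makes this set null. Hence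
-- importance sampling from q loses none of the mass of α, even though Lean's real division sets α /
-- 0 = 0.
lemma ae_eq_zero_of_secondMomentRatio_lt_top (hα_meas : Measurable α)
    (hα_nonneg : ∀ x, 0 ≤ α x) (hα_int : Integrable α) (hq_meas : Measurable q)
    (h : secondMomentRatio α q < ∞) : ∀ᵐ x, q x = 0 → α x = 0 := by
  have hI : ∫⁻ x, ENNReal.ofReal (α x) ^ 2 / ENNReal.ofReal (q x) ≠ ∞ := by
    intro htop
    rw [secondMomentRatio, htop, lintegral_ofReal_eq hα_nonneg hα_int,
      ENNReal.top_div_of_ne_top (ENNReal.pow_ne_top ENNReal.ofReal_ne_top)] at h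
    exact lt_irrefl _ h
  filter_upwards [ae_lt_top (by fun_prop) hI] with x hx hq0
  by_contra hne
  have hpos : 0 < α x := lt_of_le_of_ne (hα_nonneg x) (Ne.symm hne)
  rw [hq0, ENNReal.ofReal_zero, ENNReal.div_zero (by simpa using hpos)] at hx
  exact lt_irrefl _ hx

lemma integral_importanceWeight (hα_meas : Measurable α)
    (hα_nonneg : ∀ x, 0 ≤ α x) (hα_int : Integrable α) (hα_pos : 0 < ∫ x, α x)
    (hq_meas : Measurable q) (hq_nonneg : ∀ x, 0 ≤ q x) (h : secondMomentRatio α q < ∞) :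
    ∫ x, importanceWeight α q x ∂(proposalLaw q) = 1 := by
  rw [proposalLaw, integral_withDensity_eq_integral_toReal_smul (by fun_prop)
    (ae_of_all _ fun _ => ENNReal.ofReal_lt_top)]
  have hae : (fun x => (ENNReal.ofReal (q x)).toReal • importanceWeight α q x) =ᵐ[volume]
      fun x => α x / ∫ y, α y := by
    filter_upwards [ae_eq_zero_of_secondMomentRatio_lt_top hα_meas hα_nonneg hα_int hq_meas h]
      with x hx
    rw [ENNReal.toReal_ofReal (hq_nonneg x), smul_eq_mul, importanceWeight]
    rcases eq_or_ne (q x) 0 with h0 | h0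
    · simp [h0, hx h0]
    · field_simp
  rw [integral_congr_ae hae, integral_div, div_self hα_pos.ne']

lemma lintegral_importanceWeight_sq (hα_meas : Measurable α)
    (hα_nonneg : ∀ x, 0 ≤ α x) (hα_int : Integrable α) (hα_pos : 0 < ∫ x, α x)
    (hq_meas : Measurable q) (hq_nonneg : ∀ x, 0 ≤ q x) (h : secondMomentRatio α q < ∞) :
    ∫⁻ x, ENNReal.ofReal (importanceWeight α q x ^ 2) ∂(proposalLaw q) =
      secondMomentRatio α q := by
  have hwm := measurable_importanceWeight hα_meas hq_meas
  rw [proposalLaw, lintegral_withDensity_eq_lintegral_mul _ (by fun_prop) (by fun_prop),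
    secondMomentRatio, lintegral_ofReal_eq hα_nonneg hα_int, div_eq_mul_inv,
    ← lintegral_mul_const _ (by fun_prop)]
  refine lintegral_congr_ae ?_
  filter_upwards [ae_eq_zero_of_secondMomentRatio_lt_top hα_meas hα_nonneg hα_int hq_meas h]
    with x hx
  rw [Pi.mul_apply, importanceWeight]
  rcases (hq_nonneg x).eq_or_lt with h0 | h0
  · simp [← h0, hx h0.symm]
  · rw [← ENNReal.ofReal_pow (hα_nonneg x), ← ENNReal.ofReal_pow hα_pos.le,
      ← ENNReal.ofReal_div_of_pos h0, ← div_eq_mul_inv, ← ENNReal.ofReal_div_of_pos (by positivity),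
      ← ENNReal.ofReal_mul (hq_nonneg x)]
    congr 1
    field_simp

lemma memLp_importanceWeight (hα_meas : Measurable α)
    (hα_nonneg : ∀ x, 0 ≤ α x) (hα_int : Integrable α) (hα_pos : 0 < ∫ x, α x)
    (hq_meas : Measurable q) (hq_nonneg : ∀ x, 0 ≤ q x) (h : secondMomentRatio α q < ∞) :
    MemLp (importanceWeight α q) 2 (proposalLaw q) := by
  have hwm := measurable_importanceWeight hα_meas hq_meas
  refine (memLp_two_iff_integrable_sq hwm.aestronglyMeasurable).2
    ⟨(hwm.pow_const 2).aestronglyMeasurable, ?_⟩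
  rw [hasFiniteIntegral_iff_ofReal (ae_of_all _ fun x => sq_nonneg _),
    lintegral_importanceWeight_sq hα_meas hα_nonneg hα_int hα_pos hq_meas hq_nonneg h]
  exact h

lemma integral_importanceWeight_sq (hα_meas : Measurable α)
    (hα_nonneg : ∀ x, 0 ≤ α x) (hα_int : Integrable α) (hα_pos : 0 < ∫ x, α x)
    (hq_meas : Measurable q) (hq_nonneg : ∀ x, 0 ≤ q x)
    (hq_one : ∫⁻ x, ENNReal.ofReal (q x) = 1) (hσ : sigmaSq α q < ∞) :
    ∫ x, importanceWeight α q x ^ 2 ∂(proposalLaw q) = 1 + (sigmaSq α q).toReal := by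
  have h := secondMomentRatio_lt_top hσ
  have := isProbabilityMeasure_proposalLaw hq_one
  have hwm := measurable_importanceWeight hα_meas hq_meas
  have hE : ∫ x, importanceWeight α q x ^ 2 ∂(proposalLaw q) = (secondMomentRatio α q).toReal := by
    rw [integral_eq_lintegral_of_nonneg_ae (ae_of_all _ fun x => sq_nonneg _)
      (hwm.pow_const 2).aestronglyMeasurable,
      lintegral_importanceWeight_sq hα_meas hα_nonneg hα_int hα_pos hq_meas hq_nonneg h]
  -- A nonnegative variance with mean 1 gives a second moment of at least 1, so the truncated
  -- subtraction in `sigmaSq` is a true one.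
  have hv := variance_nonneg (importanceWeight α q) (proposalLaw q)
  rw [variance_eq_sub (memLp_importanceWeight hα_meas hα_nonneg hα_int hα_pos hq_meas hq_nonneg h),
    integral_importanceWeight hα_meas hα_nonneg hα_int hα_pos hq_meas hq_nonneg h] at hv
  simp only [Pi.pow_apply] at hv
  rw [hE] at hv ⊢
  have hle : 1 ≤ secondMomentRatio α q := by
    rw [← ENNReal.ofReal_one]
    exact ENNReal.ofReal_le_of_le_toReal (by linarith)
  rw [show sigmaSq α q = secondMomentRatio α q - 1 from rfl, ENNReal.toReal_sub_of_le hle h.ne,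
    ENNReal.toReal_one]
  ring

lemma localWeight_div_pow (α q : ℝ → ℝ) {m d : ℕ} (x : Fin m → Fin d → ℝ) :
    localWeight α q x / (∫ y, α y) ^ d =
      ∏ j, meanWeight (importanceWeight α q) fun l => x l j := by
  have h : (∫ y, α y) ^ d = ∏ _j : Fin d, ∫ y, α y := by simp
  rw [localWeight, h, ← Finset.prod_div_distrib]
  refine Finset.prod_congr rfl fun j _ => ?_
  simp_rw [meanWeight, importanceWeight, ← Finset.sum_div, mul_div_assoc]

lemma normConst_eq (α : ℝ → ℝ) (n d : ℕ) : normConst α n d = ((∫ y, α y) ^ d) ^ n := by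
  rw [normConst, integral_fintype_prod_volume_eq_pow (fun y : Fin d → ℝ => ∏ j, α (y j)),
    integral_fintype_prod_volume_eq_pow, Fintype.card_fin, Fintype.card_fin]

lemma normConstEstimate_div_normConst (α q : ℝ → ℝ) {n N m d : ℕ}
    (x : Fin n → Fin N → Fin m → Fin d → ℝ) :
    normConstEstimate α q x / normConst α n d =
      ∏ k, (1 / (N : ℝ)) * ∑ i, localWeight α q (x k i) / (∫ y, α y) ^ d := by
  have h : ((∫ y, α y) ^ d) ^ n = ∏ _k : Fin n, (∫ y, α y) ^ d := by simp
  rw [normConst_eq, normConstEstimate, h, ← Finset.prod_div_distrib]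
  simp_rw [← Finset.sum_div, mul_div_assoc]

end weight

/-! ### Independence of the blocks and conclusion -/

/-- The blocks of an i.i.d. array, indexed by `(k, i)`, are i.i.d. with product law. -/
lemma hasLaw_blocks {Ω S : Type*} [MeasurableSpace Ω] [MeasurableSpace S] {P : Measure Ω}
    {μ : Measure S} [IsProbabilityMeasure μ] {n N m d : ℕ}
    {X : Fin n → Fin N → Fin m → Fin d → Ω → S} (hX : ∀ k i l j, HasLaw (X k i l j) μ P)
    (hind : iIndepFun
      (fun a : Fin n × Fin N × Fin m × Fin d => X a.1 a.2.1 a.2.2.1 a.2.2.2) P) :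
    HasLaw (fun ω (a : Fin n × Fin N) j l => X a.1 a.2 l j ω)
      (Measure.pi fun _ => Measure.pi fun _ => Measure.pi fun _ => μ) P := by
  -- The reindexing groups by (k, i) and swaps l with j, since 𝐆 averages over l within each
  -- coordinate j.
  have hinj : Function.Injective (fun b : (Fin n × Fin N) × (Fin d × Fin m) =>
      ((b.1.1, b.1.2, b.2.2, b.2.1) : Fin n × Fin N × Fin m × Fin d)) := by
    rintro ⟨⟨k, i⟩, j, l⟩ ⟨⟨k', i'⟩, j', l'⟩ h
    simp only [Prod.mk.injEq] at h ⊢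
    tauto
  have h1 := (hind.precomp hinj).hasLaw_pi (μ := fun _ => μ) fun b => hX _ _ _ _
  have h2 := (measurePreserving_curry_pi (ι := Fin n × Fin N) (κ := Fin d × Fin m) μ).comp_hasLaw h1
  exact (measurePreserving_pi _ _ fun _ : Fin n × Fin N =>
    measurePreserving_curry_pi (ι := Fin d) (κ := Fin m) μ).comp_hasLaw h2

end SpaceTimePF


theorem mainTheorem3
    -- the model: an unnormalized target density `α` and a proposal density `q` on `ℝ`
    (α q : ℝ → ℝ)
    (hα_meas : Measurable α) (hα_nonneg : ∀ x, 0 ≤ α x)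
    (hα_int : Integrable α) (hα_pos : 0 < ∫ x, α x)
    (hq_meas : Measurable q) (hq_nonneg : ∀ x, 0 ≤ q x)
    (hq_one : ∫⁻ x, ENNReal.ofReal (q x) = 1)
    (hσ : SpaceTimePF.sigmaSq α q < ∞)
    -- `N` and `n` fixed, `M_d = d / c` up to rounding to an integer
    (n N : ℕ) (hn : 1 ≤ n) (hN : 1 ≤ N) (c : ℝ) (hc : 0 < c)
    (M : ℕ → ℕ) (hM : (fun d : ℕ => (M d : ℝ)) ~[atTop] (fun d : ℕ => (d : ℝ) / c))
    -- for every `d`, the variables `X_k^{i,l}(j)` are i.i.d. from `q`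
    {Ω : ℕ → Type*} [∀ d, MeasurableSpace (Ω d)]
    (P : ∀ d, Measure (Ω d)) [∀ d, IsProbabilityMeasure (P d)]
    (X : ∀ d, Fin n → Fin N → Fin (M d) → Fin d → Ω d → ℝ)
    (hX_law : ∀ d k i l j, HasLaw (X d k i l j) (SpaceTimePF.proposalLaw q) (P d))
    (hX_indep : ∀ d, iIndepFun
      (fun a : Fin n × Fin N × Fin (M d) × Fin d => X d a.1 a.2.1 a.2.2.1 a.2.2.2) (P d))
    -- the variables `V_k^i` are i.i.d. from `LN(-cσ²/2, cσ²)`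
    {Ω' : Type*} [MeasurableSpace Ω'] (P' : Measure Ω') [IsProbabilityMeasure P']
    (V : Fin n → Fin N → Ω' → ℝ)
    (hV_law : ∀ k i, HasLaw (V k i)
      (SpaceTimePF.logNormal (-(c * (SpaceTimePF.sigmaSq α q).toReal) / 2)
        (c * (SpaceTimePF.sigmaSq α q).toReal).toNNReal) P')
    (hV_indep : iIndepFun (fun a : Fin n × Fin N => V a.1 a.2) P') :
    (∀ k i, TendstoInDistribution
      (fun d ω => SpaceTimePF.localWeight α q (fun l j => X d k i l j ω) / (∫ x, α x) ^ d)
      atTop (V k i) P P') ∧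
    TendstoInDistribution
      (fun d ω => SpaceTimePF.normConstEstimate α q (fun k i l j => X d k i l j ω) /
        SpaceTimePF.normConst α n d)
      atTop (fun ω => ∏ k, (1 / (N : ℝ)) * ∑ i, V k i ω) P P' := by
  open SpaceTimePF in
  set w := importanceWeight α q
  have := isProbabilityMeasure_proposalLaw hq_one
  have hratio := secondMomentRatio_lt_top hσ
  have hw := measurable_importanceWeight hα_meas hq_meas
  have hlim := tendstoInDistribution_prod_meanWeight hw
    (importanceWeight_nonneg hα_nonneg hq_nonneg)
    (memLp_importanceWeight hα_meas hα_nonneg hα_int hα_pos hq_meas hq_nonneg hratio)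
    (integral_importanceWeight hα_meas hα_nonneg hα_int hα_pos hq_meas hq_nonneg hratio)
    ENNReal.toReal_nonneg
    (integral_importanceWeight_sq hα_meas hα_nonneg hα_int hα_pos hq_meas hq_nonneg hq_one hσ)
    hc hM
  have hY (d : ℕ) : HasLaw
      (fun ω (a : Fin n × Fin N) => ∏ j, meanWeight w fun l => X d a.1 a.2 l j ω)
      (Measure.pi fun _ => (Measure.pi fun _ : Fin d => Measure.pi fun _ : Fin (M d) =>
        proposalLaw q).map fun x => ∏ j, meanWeight w (x j)) (P d) := by
    have hg : Measurable fun x : Fin d → Fin (M d) → ℝ => ∏ j, meanWeight w (x j) := by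
      have := measurable_meanWeight hw (M d)
      fun_prop
    have := Measure.isProbabilityMeasure_map (μ := Measure.pi fun _ : Fin d =>
      Measure.pi fun _ : Fin (M d) => proposalLaw q) hg.aemeasurable
    exact (measurePreserving_pi _ _ fun _ : Fin n × Fin N => hg.measurePreserving
      (Measure.pi fun _ : Fin d => Measure.pi fun _ : Fin (M d) => proposalLaw q)).comp_hasLaw
      (hasLaw_blocks (hX_law d) (hX_indep d))
  -- Joint convergence of all n * N normalized weights; marginal convergence alone would not give
  -- the limit of the estimator.
  have hvec := tendstoInDistribution_of_hasLaw_pi hlim hY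
    (hV_indep.hasLaw_pi fun a => hV_law a.1 a.2)
  constructor
  · intro k i
    simp_rw [localWeight_div_pow]
    exact hvec.continuous_comp (continuous_apply (k, i))
  · simp_rw [normConstEstimate_div_normConst, localWeight_div_pow]
    exact hvec.continuous_comp
      (g := fun v : Fin n × Fin N → ℝ => ∏ k, (1 / (N : ℝ)) * ∑ i, v (k, i)) (by fun_prop)
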